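/- Let $K$ be a field of characteristic $0$, let $d\ge 0$ be an integer and let $\mathfrak{L}^-$ be a set. For a set $I$ let $M(I)$ be the set of finitely supported maps $I\to\mathbb{N}$; for $w\in M(I)$ put $|w|=\sum_{i\in I}w(i)$, and for $i\in I$ let $iw\in M(I)$ be the map $w$ with its value at $i$ raised by $1$. For a set $A$, a multi-Novikov algebra with operations indexed by $A$ is a $K$-vector space with bilinear products $\triangleright_a$, $a\in A$, such that for all $a,b\in A$ and all $x,y,z$ $$(x\triangleright_a y)\triangleright_b z-x\triangleright_a(y\triangleright_b z)=(y\triangleright_a x)\triangleright_b z-y\triangleright_a(x\triangleright_b z),$$ $$(x\triangleright_a y)\triangleright_b z-x\triangleright_a(y\triangleright_b z)=(x\triangleright_b y)\triangleright_a z-x\triangleright_b(y\triangleright_a z),$$ $$(x\triangleright_a y)\triangleright_b z=(x\triangleright_b z)\triangleright_a y.$$ In the polynomial algebra over $K$ in the variables $z_{(\mathfrak{l},w)}$, $(\mathfrak{l},w)\in\mathfrak{L}^-\times M(\mathbb{N}^{d+1})$, write $z^\beta=\prod_{(\mathfrak{l},w)}z_{(\mathfrak{l},w)}^{\beta(\mathfrak{l},w)}$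 for $\beta\in M(\mathfrak{L}^-\times M(\mathbb{N}^{d+1}))$, and for $\mathbf{n}\in\mathbb{N}^{d+1}$ let $D^{(\mathbf{n})}$ be the $K$-linear derivation with $D^{(\mathbf{n})}z_{(\mathfrak{l},w)}=(w(\mathbf{n})+1)\,z_{(\mathfrak{l},\mathbf{n}w)}$. Call $\beta$ populated if $\sum_{(\mathfrak{l},w)}(1-|w|)\,\beta(\mathfrak{l},w)=1$, and let $\mathcal{M}^{\mathrm{gen}}$ be the span of all $z^\beta$ with $\beta$ populated. **Theorem.** The space $\mathcal{M}^{\mathrm{gen}}$ is stable under the products $p\triangleright_{\mathbf{n}}q=p\,D^{(\mathbf{n})}(q)$, $\mathbf{n}\in\mathbb{N}^{d+1}$, and is a multi-Novikov algebra with them. It is isomorphic, as a multi-Novikov algebra with operations indexed by $\mathbb{N}^{d+1}$, to the free multi-Novikov algebra generated by the set $\mathfrak{L}^-$, by an isomorphism that sends each generator $\mathfrak{l}$ to the variable $z_{(\mathfrak{l},\emptyset)}$, where $\emptyset$ is the zero map (the empty word). -/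

import Mathlib

noncomputable section

/-- A (left) multi-Novikov algebra over `K` with operations indexed by `A`: a vector space `M` with
bilinear products `op a x y` (mathematically `x ▷_a y`), satisfying the three identities below. -/
class MultiNovikovAlgebra (K A M : Type*) [Field K] [AddCommGroup M] [Module K M] where
  /-- the product `x ▷_a y` -/
  op : A → M →ₗ[K] M →ₗ[K] M
  assoc_left_symm : ∀ (a b : A) (x y z : M),
    op b (op a x y) z - op a x (op b y z) = op b (op a y x) z - op a y (op b x z)
  assoc_index_symm : ∀ (a b : A) (x y z : M),
    op b (op a x y) z - op a x (op b y z) = op a (op b x y) z - op b x (op a y z)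
  right_comm : ∀ (a b : A) (x y z : M), op b (op a x y) z = op a (op b x z) y

/-! ### The free multi-Novikov algebra -/

/-- Monomials of the free multi-magmatic algebra: binary trees with leaves labelled by `X` and
internal vertices labelled by `A`. -/
inductive MultiMagma (A X : Type*) where
  | leaf : X → MultiMagma A X
  | node : A → MultiMagma A X → MultiMagma A X → MultiMagma A X

/-- The free multi-magmatic algebra: the vector space with basis the monomials. -/
abbrev MultiMagAlgebra (K A X : Type*) [Field K] := MultiMagma A X →₀ K

namespace MultiMagAlgebra

variable {K A X : Type*} [Field K]

/-- The bilinear product indexed by `a`, grafting two basis trees onto a new root labelled `a`. -/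
def op (a : A) : MultiMagAlgebra K A X →ₗ[K] MultiMagAlgebra K A X →ₗ[K] MultiMagAlgebra K A X :=
  Finsupp.lsum K fun s => LinearMap.toSpanSingleton K _
    (Finsupp.lmapDomain K K (MultiMagma.node a s))

lemma op_single (a : A) (s t : MultiMagma A X) :
    op a (Finsupp.single s (1 : K)) (Finsupp.single t 1) =
      Finsupp.single (MultiMagma.node a s t) 1 := by
  simp [op]

/-- Membership in the two-sided ideal generated by the multi-Novikov identities. -/
inductive NovikovRel : MultiMagAlgebra K A X → Prop
  | assoc_left_symm (a b : A) (x y z : MultiMagAlgebra K A X) :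
      NovikovRel ((op b (op a x y) z - op a x (op b y z)) -
        (op b (op a y x) z - op a y (op b x z)))
  | assoc_index_symm (a b : A) (x y z : MultiMagAlgebra K A X) :
      NovikovRel ((op b (op a x y) z - op a x (op b y z)) -
        (op a (op b x y) z - op b x (op a y z)))
  | right_comm (a b : A) (x y z : MultiMagAlgebra K A X) :
      NovikovRel (op b (op a x y) z - op a (op b x z) y)
  | zero : NovikovRel 0
  | add {x y : MultiMagAlgebra K A X} : NovikovRel x → NovikovRel y → NovikovRel (x + y)
  | smul (c : K) {x : MultiMagAlgebra K A X} : NovikovRel x → NovikovRel (c • x)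
  | op_left (a : A) {x : MultiMagAlgebra K A X} (y : MultiMagAlgebra K A X) :
      NovikovRel x → NovikovRel (op a x y)
  | op_right (a : A) (x : MultiMagAlgebra K A X) {y : MultiMagAlgebra K A X} :
      NovikovRel y → NovikovRel (op a x y)

variable (K A X) in
/-- The two-sided ideal generated by the multi-Novikov identities. -/
def novikovIdeal : Submodule K (MultiMagAlgebra K A X) where
  carrier := {x | NovikovRel x}
  add_mem' := NovikovRel.add
  zero_mem' := NovikovRel.zero
  smul_mem' c _ h := NovikovRel.smul c h

end MultiMagAlgebra

/-- The free multi-Novikov algebra generated by the set `X`, with operations indexed by `A`. -/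
abbrev FreeMultiNovikov (K A X : Type*) [Field K] :=
  MultiMagAlgebra K A X ⧸ MultiMagAlgebra.novikovIdeal K A X

namespace FreeMultiNovikov

open MultiMagAlgebra

variable {K A X : Type*} [Field K]

/-- The product of the free multi-Novikov algebra, induced by that of the multi-magmatic algebra. -/
def op (a : A) : FreeMultiNovikov K A X →ₗ[K] FreeMultiNovikov K A X →ₗ[K]
    FreeMultiNovikov K A X :=
  (novikovIdeal K A X).liftQ
    { toFun := fun x => (novikovIdeal K A X).mapQ (novikovIdeal K A X) (MultiMagAlgebra.op a x)
        fun _ hy => NovikovRel.op_right a x hy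
      map_add' := fun x y => by
        refine Submodule.linearMap_qext _ (LinearMap.ext fun z => ?_)
        change (novikovIdeal K A X).mkQ _ = (novikovIdeal K A X).mkQ (MultiMagAlgebra.op a x z) +
          (novikovIdeal K A X).mkQ (MultiMagAlgebra.op a y z)
        simp
      map_smul' := fun c x => by
        refine Submodule.linearMap_qext _ (LinearMap.ext fun z => ?_)
        change (novikovIdeal K A X).mkQ _ = c • (novikovIdeal K A X).mkQ (MultiMagAlgebra.op a x z)
        simp }
    (fun x hx => by
      refine Submodule.linearMap_qext _ (LinearMap.ext fun z => ?_)
      exact (Submodule.Quotient.mk_eq_zero _).2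
        (show MultiMagAlgebra.op a x z ∈ novikovIdeal K A X from NovikovRel.op_left a z hx))

lemma op_mk (a : A) (x y : MultiMagAlgebra K A X) :
    op a ((novikovIdeal K A X).mkQ x) ((novikovIdeal K A X).mkQ y) =
      (novikovIdeal K A X).mkQ (MultiMagAlgebra.op a x y) := rfl

instance : MultiNovikovAlgebra K A (FreeMultiNovikov K A X) where
  op := op
  assoc_left_symm a b x y z := by
    obtain ⟨x, rfl⟩ := (novikovIdeal K A X).mkQ_surjective x
    obtain ⟨y, rfl⟩ := (novikovIdeal K A X).mkQ_surjective y
    obtain ⟨z, rfl⟩ := (novikovIdeal K A X).mkQ_surjective z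
    simp only [op_mk, ← map_sub]
    exact (Submodule.Quotient.eq _).2 (NovikovRel.assoc_left_symm a b x y z)
  assoc_index_symm a b x y z := by
    obtain ⟨x, rfl⟩ := (novikovIdeal K A X).mkQ_surjective x
    obtain ⟨y, rfl⟩ := (novikovIdeal K A X).mkQ_surjective y
    obtain ⟨z, rfl⟩ := (novikovIdeal K A X).mkQ_surjective z
    simp only [op_mk, ← map_sub]
    exact (Submodule.Quotient.eq _).2 (NovikovRel.assoc_index_symm a b x y z)
  right_comm a b x y z := by
    obtain ⟨x, rfl⟩ := (novikovIdeal K A X).mkQ_surjective x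
    obtain ⟨y, rfl⟩ := (novikovIdeal K A X).mkQ_surjective y
    obtain ⟨z, rfl⟩ := (novikovIdeal K A X).mkQ_surjective z
    simp only [op_mk]
    exact (Submodule.Quotient.eq _).2 (NovikovRel.right_comm a b x y z)

variable (K A) in
/-- The generator of the free multi-Novikov algebra attached to `x`. -/
def of (x : X) : FreeMultiNovikov K A X :=
  (novikovIdeal K A X).mkQ (Finsupp.single (MultiMagma.leaf x) 1)

/-- The universal property of the free multi-Novikov algebra. -/
theorem existsUnique_lift {N : Type*} [AddCommGroup N] [Module K N] [MultiNovikovAlgebra K A N]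
    (f : X → N) :
    ∃! φ : FreeMultiNovikov K A X →ₗ[K] N,
      (∀ (a : A) (x y : FreeMultiNovikov K A X),
        φ (MultiNovikovAlgebra.op (K := K) a x y) = MultiNovikovAlgebra.op (K := K) a (φ x) (φ y)) ∧
      ∀ x, φ (of K A x) = f x := by
  let g : MultiMagma A X → N := fun t =>
    MultiMagma.rec f (fun a _ _ u v => MultiNovikovAlgebra.op (K := K) a u v) t
  let ψ : MultiMagAlgebra K A X →ₗ[K] N := Finsupp.linearCombination K g
  have hψ : ∀ (a : A) (x y : MultiMagAlgebra K A X),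
      ψ (MultiMagAlgebra.op a x y) = MultiNovikovAlgebra.op (K := K) a (ψ x) (ψ y) := by
    intro a x y
    have h : (MultiMagAlgebra.op a).compr₂ ψ =
        (MultiNovikovAlgebra.op (K := K) (M := N) a).compl₁₂ ψ ψ := by
      refine Finsupp.lhom_ext' fun s => LinearMap.ext_ring (Finsupp.lhom_ext' fun t =>
        LinearMap.ext_ring ?_)
      simp [MultiMagAlgebra.op_single, ψ, g]
    exact LinearMap.congr_fun (LinearMap.congr_fun h x) y
  have hI : novikovIdeal K A X ≤ LinearMap.ker ψ := by
    intro x hx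
    change NovikovRel x at hx
    rw [LinearMap.mem_ker]
    induction hx with
    | assoc_left_symm a b x y z =>
      simp only [map_sub, hψ, MultiNovikovAlgebra.assoc_left_symm a b (ψ x) (ψ y) (ψ z), sub_self]
    | assoc_index_symm a b x y z =>
      simp only [map_sub, hψ, MultiNovikovAlgebra.assoc_index_symm a b (ψ x) (ψ y) (ψ z), sub_self]
    | right_comm a b x y z =>
      simp only [map_sub, hψ, MultiNovikovAlgebra.right_comm a b (ψ x) (ψ y) (ψ z), sub_self]
    | zero => simp
    | add _ _ h1 h2 => simp [h1, h2]
    | smul c _ h => simp [h]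
    | op_left a y _ h => simp [hψ, h]
    | op_right a x _ h => simp [hψ, h]
  refine ⟨(novikovIdeal K A X).liftQ ψ hI, ⟨fun a x y => ?_, fun x => ?_⟩, fun φ ⟨h1, h2⟩ => ?_⟩
  · obtain ⟨x, rfl⟩ := (novikovIdeal K A X).mkQ_surjective x
    obtain ⟨y, rfl⟩ := (novikovIdeal K A X).mkQ_surjective y
    exact hψ a x y
  · change ψ (Finsupp.single (MultiMagma.leaf x) 1) = f x
    simp [ψ, g]
  · refine Submodule.linearMap_qext _ (Finsupp.lhom_ext' fun t => LinearMap.ext_ring ?_)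
    change φ ((novikovIdeal K A X).mkQ (Finsupp.single t 1)) = ψ (Finsupp.single t 1)
    induction t with
    | leaf x => exact (h2 x).trans (by simp [ψ, g])
    | node a s t hs ht =>
      rw [← MultiMagAlgebra.op_single, hψ, ← op_mk, ← hs, ← ht]
      exact h1 a _ _

end FreeMultiNovikov

/-! ### Populated general multi-indices -/

namespace GeneralMultiIndex

open MvPolynomial

/-- The alphabet `ℕ^{d+1}`. -/
abbrev Letter (d : ℕ) := Fin (d + 1) → ℕ

/-- The index set of the variables `z_{(l,w)}`: pairs of `l ∈ L` and a commutative word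
(finitely supported multiplicity function) `w` in the letters `ℕ^{d+1}`. -/
abbrev Var (d : ℕ) (L : Type*) := L × (Letter d →₀ ℕ)

/-- The polynomial algebra spanned by all the monomials `z^β`. -/
abbrev Poly (K : Type*) [Field K] (d : ℕ) (L : Type*) := MvPolynomial (Var d L) K

variable (K : Type*) [Field K] {d : ℕ} {L : Type*}

/-- The derivation `D^{(n)}`, with `D^{(n)} z_{(l,w)} = (w(n) + 1) z_{(l,nw)}`. -/
def D (n : Letter d) : Derivation K (Poly K d L) (Poly K d L) :=
  mkDerivation K fun v : Var d L => (v.2 n + 1) • X (v.1, v.2 + Finsupp.single n 1)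

/-- A multi-index `β` is populated if `∑_{(l,w)} (1 - |w|) β(l,w) = 1`, where `|w|` is the degree
of the word `w`. -/
def Populated (β : Var d L →₀ ℕ) : Prop :=
  (β.sum fun v k => (1 - (v.2.degree : ℤ)) * (k : ℤ)) = 1

variable (d L) in
/-- The span of the monomials `z^β` with `β` populated. -/
def populatedSpan : Submodule K (Poly K d L) :=
  Submodule.span K {p | ∃ β : Var d L →₀ ℕ, Populated β ∧ p = monomial β 1}

/-- The product `p ▷_n q = p * D^{(n)} q` on the polynomial algebra. -/
def polyOp (n : Letter d) : Poly K d L →ₗ[K] Poly K d L →ₗ[K] Poly K d L :=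
  (LinearMap.mul K (Poly K d L)).compl₂ (D K n).toLinearMap

lemma polyOp_apply (n : Letter d) (p q : Poly K d L) : polyOp K n p q = p * D K n q := rfl

/-- The additive weight whose value `1` characterises populated multi-indices. -/
def weight : (Var d L →₀ ℕ) →+ ℤ :=
  Finsupp.liftAddHom fun v => (AddMonoidHom.mulLeft (1 - (v.2.degree : ℤ))).comp
    (Nat.castAddMonoidHom ℤ)

lemma populated_iff (β : Var d L →₀ ℕ) : Populated β ↔ weight β = 1 := Iff.rfl

lemma weight_single (v : Var d L) (k : ℕ) :
    weight (Finsupp.single v k) = (1 - (v.2.degree : ℤ)) * k := by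
  simp [weight]

lemma monomial_mem {β : Var d L →₀ ℕ} (h : Populated β) :
    (monomial β 1 : Poly K d L) ∈ populatedSpan K d L :=
  Submodule.subset_span ⟨β, h, rfl⟩

/-- The span of the populated multi-indices is stable under the products. -/
lemma polyOp_mem (n : Letter d) {p q : Poly K d L} (hp : p ∈ populatedSpan K d L)
    (hq : q ∈ populatedSpan K d L) : polyOp K n p q ∈ populatedSpan K d L := by
  unfold populatedSpan at hp hq
  induction hp using Submodule.span_induction with
  | zero => simp
  | add x y _ _ h1 h2 => simpa using add_mem h1 h2
  | smul c x _ h => simpa using Submodule.smul_mem _ c h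
  | mem x hx =>
    induction hq using Submodule.span_induction with
    | zero => simp
    | add y z _ _ h1 h2 => simpa using add_mem h1 h2
    | smul c y _ h => simpa using Submodule.smul_mem _ c h
    | mem y hy =>
      obtain ⟨β, hβ, rfl⟩ := hx
      obtain ⟨γ, hγ, rfl⟩ := hy
      rw [polyOp_apply, D, mkDerivation_monomial, one_smul, Finsupp.sum, Finset.mul_sum]
      refine Submodule.sum_mem _ fun v hv => ?_
      have hle : Finsupp.single v 1 ≤ γ := by
        simpa [Finsupp.single_le_iff, Nat.one_le_iff_ne_zero] using hv
      have key : (monomial β 1 : Poly K d L) * (monomial (γ - Finsupp.single v 1) (γ v : K) •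
          ((v.2 n + 1) • X (v.1, v.2 + Finsupp.single n 1))) =
          ((γ v : K) * ((v.2 n + 1 : ℕ) : K)) •
            monomial (β + ((γ - Finsupp.single v 1) +
              Finsupp.single (v.1, v.2 + Finsupp.single n 1) 1)) 1 := by
        rw [← Nat.cast_smul_eq_nsmul K, smul_eq_mul, X, smul_monomial, monomial_mul,
          monomial_mul, smul_monomial]
        simp
      rw [key]
      refine Submodule.smul_mem _ _ (monomial_mem K ?_)
      rw [populated_iff] at hβ hγ ⊢
      have h1 : weight (γ - Finsupp.single v 1) + weight (Finsupp.single v 1) = 1 := by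
        rw [← map_add, tsub_add_cancel_of_le hle, hγ]
      simp only [weight_single, map_add, Finsupp.degree_single, Nat.cast_add, Nat.cast_one] at h1 ⊢
      linarith

lemma D_comm (m n : Letter d) (p : Poly K d L) : D K m (D K n p) = D K n (D K m p) := by
  have h : ⁅(D K m : Derivation K (Poly K d L) (Poly K d L)), (D K n : Derivation K (Poly K d L) (Poly K d L))⁆ = 0 := by
    refine MvPolynomial.derivation_ext fun v => ?_
    rw [Derivation.commutator_apply]
    obtain rfl | hmn := eq_or_ne m n
    · simp
    · simp only [D, mkDerivation_X, map_nsmul, Finsupp.add_apply, Finsupp.single_apply, hmn,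
        hmn.symm, if_false, add_zero, Derivation.coe_zero, Pi.zero_apply, add_assoc,
        add_comm (Finsupp.single m 1) (Finsupp.single n 1)]
      rw [smul_comm, sub_self]
  have h2 := DFunLike.congr_fun h p
  rw [Derivation.commutator_apply] at h2
  exact sub_eq_zero.1 h2

/-- The product `▷_n` on the span of the populated multi-indices. -/
def op (n : Letter d) : populatedSpan K d L →ₗ[K] populatedSpan K d L →ₗ[K] populatedSpan K d L :=
  LinearMap.mk₂ K (fun p q => ⟨polyOp K n p q, polyOp_mem K n p.2 q.2⟩)
    (fun _ _ _ => Subtype.ext (by simp)) (fun _ _ _ => Subtype.ext (by simp))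
    (fun _ _ _ => Subtype.ext (by simp)) (fun _ _ _ => Subtype.ext (by simp))

lemma coe_op (n : Letter d) (p q : populatedSpan K d L) :
    (op K n p q : Poly K d L) = (p : Poly K d L) * D K n (q : Poly K d L) := rfl

/-- The multi-Novikov algebra of populated general multi-indices. -/
instance : MultiNovikovAlgebra K (Letter d) (populatedSpan K d L) where
  op := op K
  assoc_left_symm a b x y z := Subtype.ext <| by
    simp only [AddSubgroupClass.coe_sub, coe_op, Derivation.leibniz, smul_eq_mul]
    ring
  assoc_index_symm a b x y z := Subtype.ext <| by
    simp only [AddSubgroupClass.coe_sub, coe_op, Derivation.leibniz, smul_eq_mul, D_comm K a b]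
    ring
  right_comm a b x y z := Subtype.ext <| by
    simp only [coe_op]
    ring

variable (d) in
/-- The populated multi-index `z_{(l,1)}`, where `1` is the empty word. -/
def gen (l : L) : populatedSpan K d L :=
  ⟨X (l, 0), monomial_mem K (by simp [populated_iff, weight_single])⟩

end GeneralMultiIndex

end

noncomputable section

/-! The universal property gives the map `ψ` from the free algebra to polynomials; it must be shown
bijective. The inverse would send `z_{(l,w)}` to a multiple of `D^w x_l`, but neither `D^w x_l` nor
a product of elements exists in an abstract multi-Novikov algebra `N`. What exists is the
commutative algebra generated by the right multiplications, whose elements behave like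
multiplications by polynomials. There the Leibniz rule, solved for its top term, defines recursively
the multiplication by `(∏ q ∈ μ, x q) * D^w y` when `|μ| + 1 = |w|` (`braceOp`).

The three identities make this usable: right commutativity makes the operators commute, left
symmetry makes the arguments exchangeable with the element acted on (`braceOp_exchange`), and index
symmetry makes the word commutative (`braceOp_perm`). Hence a product of braces applied to a
generator depends only on the multi-index it represents (`IsBraceProd.apply_eq`). Such values span
the free algebra (`op_mem_braceSpan`), and in characteristic `0` they map to nonzero multiples of
monomials, which gives injectivity. Every populated multi-index is represented
(`exists_isBraceMonomial`), which gives surjectivity. -/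

/-- The sum of `g q (μ - q)` over the elements `q` of the multiset `μ`, with multiplicity. -/
def Multiset.eraseSum {L M : Type*} [DecidableEq L] [AddCommMonoid M] (μ : Multiset L)
    (g : L → Multiset L → M) : M :=
  (μ.map fun q => g q (μ.erase q)).sum

/-! ### Sums over the removal of one element from a multiset -/

namespace Multiset

variable {L M : Type*} [DecidableEq L] [AddCommMonoid M]

@[simp]
lemma eraseSum_zero (g : L → Multiset L → M) : eraseSum 0 g = 0 := by
  simp [eraseSum]

lemma eraseSum_cons (p : L) (ν : Multiset L) (g : L → Multiset L → M) :
    eraseSum (p ::ₘ ν) g = g p ν + eraseSum ν fun q τ => g q (p ::ₘ τ) := by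
  simp only [eraseSum, map_cons, sum_cons, erase_cons_head]
  congr 2
  exact map_congr rfl fun q hq => by rw [erase_cons_tail_of_mem hq]

lemma eraseSum_congr {μ : Multiset L} {g h : L → Multiset L → M}
    (H : ∀ q τ, q ::ₘ τ = μ → g q τ = h q τ) : eraseSum μ g = eraseSum μ h := by
  unfold eraseSum
  exact congrArg sum (map_congr rfl fun q hq => H q _ (cons_erase hq))

lemma eraseSum_add (μ : Multiset L) (g h : L → Multiset L → M) :
    eraseSum μ (fun q τ => g q τ + h q τ) = eraseSum μ g + eraseSum μ h := by
  simp [eraseSum, sum_map_add]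

lemma map_eraseSum {M' F : Type*} [AddCommMonoid M'] [FunLike F M M'] [AddMonoidHomClass F M M']
    (φ : F) (μ : Multiset L) (g : L → Multiset L → M) :
    φ (eraseSum μ g) = eraseSum μ fun q τ => φ (g q τ) := by
  simp [eraseSum, map_multiset_sum]

lemma mul_eraseSum {R : Type*} [NonUnitalNonAssocSemiring R] (a : R) (μ : Multiset L)
    (g : L → Multiset L → R) : a * eraseSum μ g = eraseSum μ fun q τ => a * g q τ := by
  simp [eraseSum, sum_map_mul_left]

lemma eraseSum_comm (μ : Multiset L) (h : L → L → Multiset L → M) :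
    eraseSum μ (fun q τ => eraseSum τ (h q)) =
      eraseSum μ fun q τ => eraseSum τ fun q' => h q' q := by
  induction μ using Multiset.induction generalizing h with
  | empty => simp
  | cons p ν ih =>
    simp only [eraseSum_cons, eraseSum_add]
    rw [ih fun q q' τ => h q q' (p ::ₘ τ), add_left_comm]

end Multiset

/-! ### The commutative algebra of right multiplications -/

namespace MultiNovikovAlgebra

variable (K : Type*) {A N L : Type*} [Field K] [AddCommGroup N] [Module K N]
  [MultiNovikovAlgebra K A N]

/-- Right multiplication by `y` for the product indexed by `a`. -/
def rmul (a : A) (y : N) : Module.End K N := (op (K := K) a).flip y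

@[simp]
lemma rmul_apply (a : A) (x y : N) : rmul K a y x = op (K := K) a x y := rfl

variable (A N) in
/-- The algebra generated by the right multiplications. -/
def rightAlgebra : Subalgebra K (Module.End K N) :=
  Algebra.adjoin K (Set.range fun p : A × N => rmul K p.1 p.2)

lemma rmul_mem (a : A) (y : N) : rmul K a y ∈ rightAlgebra K A N :=
  Algebra.subset_adjoin ⟨(a, y), rfl⟩

variable {K}

/-- On right multiplications this is right commutativity, and it passes to sums and products. With
`r` in the role of a multiplication operator, it says `r * (p * D z) = (r * p) * D z`. -/
lemma rightAlgebra_apply_op {r : Module.End K N} (hr : r ∈ rightAlgebra K A N) (b : A) (p z : N) :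
    r (op (K := K) b p z) = op (K := K) b (r p) z := by
  unfold rightAlgebra at hr
  induction hr using Algebra.adjoin_induction generalizing p with
  | mem r hr =>
    obtain ⟨⟨a, y⟩, rfl⟩ := hr
    exact right_comm b a p z y
  | algebraMap c => simp [Module.algebraMap_end_apply]
  | add r s _ _ h1 h2 => simp [h1, h2]
  | mul r s _ _ h1 h2 => simp [h1, h2]

lemma rightAlgebra_commute {r s : Module.End K N} (hr : r ∈ rightAlgebra K A N)
    (hs : s ∈ rightAlgebra K A N) : r * s = s * r := by
  unfold rightAlgebra at hs
  induction hs using Algebra.adjoin_induction with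
  | mem s hs =>
    obtain ⟨⟨a, y⟩, rfl⟩ := hs
    exact LinearMap.ext fun x => rightAlgebra_apply_op hr a x y
  | algebraMap c => exact (Algebra.commutes c r).symm
  | add s t _ _ h1 h2 => rw [mul_add, add_mul, h1, h2]
  | mul s t _ _ h1 h2 => rw [← mul_assoc, h1, mul_assoc, h2, mul_assoc]

lemma rightAlgebra_apply_comm {r s : Module.End K N} (hr : r ∈ rightAlgebra K A N)
    (hs : s ∈ rightAlgebra K A N) (x : N) : r (s x) = s (r x) :=
  LinearMap.congr_fun (rightAlgebra_commute hr hs) x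

/-- In the polynomial model both sides are `p * q * D r`. Left symmetry is the case where `r` is a
right multiplication. -/
lemma op_rightAlgebra_symm {r : Module.End K N} (hr : r ∈ rightAlgebra K A N) (a : A) (p q : N) :
    op (K := K) a p (r q) - r (op (K := K) a p q) =
      op (K := K) a q (r p) - r (op (K := K) a q p) := by
  have hr' := hr
  unfold rightAlgebra at hr
  induction hr using Algebra.adjoin_induction generalizing p q with
  | mem r hr =>
    obtain ⟨⟨b, y⟩, rfl⟩ := hr
    have := assoc_left_symm (K := K) a b p q y
    simp only [rmul_apply]
    rw [← neg_sub, this, neg_sub]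
  | algebraMap c => simp [Module.algebraMap_end_apply]
  | add r s hr hs h1 h2 =>
    simp only [LinearMap.add_apply, map_add, add_sub_add_comm, h1 p q hr, h2 p q hs]
  | mul r s hr hs h1 h2 =>
    -- The Leibniz rule for `D (r * s)`, with the defect of `r` rewritten by symmetry so that `s`
    -- can be pulled out of it.
    have key : ∀ p q : N, op (K := K) a p (r (s q)) - r (s (op (K := K) a p q)) =
        s (op (K := K) a q (r p) - r (op (K := K) a q p)) +
          r (op (K := K) a p (s q) - s (op (K := K) a p q)) := by
      intro p q
      have h := h1 p (s q) hr
      rw [← rightAlgebra_apply_op hs, ← rightAlgebra_apply_op hs] at h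
      rw [map_sub, map_sub, ← rightAlgebra_apply_comm hr hs (op (K := K) a q p), ← h]
      abel
    simp only [Module.End.mul_apply]
    rw [key, key, h1 p q hr, h2 p q hs]

/-- This is `D (r * y) = y * D r + r * D y`: the commutator plays the role of multiplication by `y *
D r`. -/
lemma rmul_rightAlgebra_apply {r : Module.End K N} (hr : r ∈ rightAlgebra K A N) (a : A) (y : N) :
    rmul K a (r y) = (op (K := K) a y * r - r * op (K := K) a y) + r * rmul K a y := by
  ext p
  have := op_rightAlgebra_symm hr a p y
  simp only [rmul_apply, LinearMap.add_apply, LinearMap.sub_apply, Module.End.mul_apply]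
  rw [← this, sub_add_cancel]

/-! ### Braces -/

variable (K) [DecidableEq L] (x : L → N) (y : N)

/-- For a word `w` of letters and a multiset `μ` of generators, the first component is to be thought
of as the multiplication by `(∏ q ∈ μ, x q) * D^w y` when `|μ| + 1 = |w|`, and the second one as
the element `(∏ q ∈ μ, x q) * D^w y` when `|μ| = |w|`. -/
def braceAux : List A → (Multiset L → Module.End K N) × (Multiset L → N)
  | [] => (0, fun _ => y)
  | a :: w =>
    -- The Leibniz rule for `D^a` of `(∏ q ∈ μ, x q) * D^w y`, solved for the term where `D^a`
    -- reaches `D^w y`.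
    let f : Multiset L → Module.End K N := fun μ => rmul K a ((braceAux w).2 μ) -
      μ.eraseSum fun q τ => rmul K a (x q) * (braceAux w).1 τ
    -- An arbitrary argument is used as the element acted on; `brace_cons` removes the dependence on
    -- this choice. The default `0` is irrelevant, since `|μ|` should equal the positive length of
    -- `a :: w`.
    (f, open Classical in fun μ =>
      if h : ∃ p, p ∈ μ then f (μ.erase h.choose) (x h.choose) else 0)

/-- The multiplication by `(∏ q ∈ μ, x q) * D^w y`, where `|μ| + 1 = |w|`. -/
def braceOp (w : List A) (μ : Multiset L) : Module.End K N := (braceAux K x y w).1 μ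

/-- The element `(∏ q ∈ μ, x q) * D^w y`, where `|μ| = |w|`. -/
def brace (w : List A) (μ : Multiset L) : N := (braceAux K x y w).2 μ

lemma brace_nil (μ : Multiset L) : brace K x y ([] : List A) μ = y := rfl

lemma braceOp_cons (a : A) (w : List A) (μ : Multiset L) :
    braceOp K x y (a :: w) μ = rmul K a (brace K x y w μ) -
      μ.eraseSum fun q τ => rmul K a (x q) * braceOp K x y w τ := rfl

lemma exists_brace_cons (a : A) (w : List A) {μ : Multiset L} (h : μ ≠ 0) :
    ∃ p ν, p ::ₘ ν = μ ∧ brace K x y (a :: w) μ = braceOp K x y (a :: w) ν (x p) := by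
  have h' := Multiset.exists_mem_of_ne_zero h
  refine ⟨h'.choose, _, Multiset.cons_erase h'.choose_spec, ?_⟩
  exact dif_pos h'

lemma braceOp_singleton (a : A) : braceOp K x y [a] 0 = rmul K a y := by
  simp [braceOp_cons, brace_nil]

lemma braceOp_mem (w : List A) (μ : Multiset L) : braceOp K x y w μ ∈ rightAlgebra K A N := by
  induction w generalizing μ with
  | nil => exact zero_mem _
  | cons a w ih =>
    refine sub_mem (rmul_mem K _ _) (multiset_sum_mem _ fun r hr => ?_)
    obtain ⟨q, -, rfl⟩ := Multiset.mem_map.1 hr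
    exact mul_mem (rmul_mem K _ _) (ih _)

lemma braceOp_exchange_of_brace (a : A) (w : List A)
    (ih : ∀ p ν, Multiset.card ν + 1 = w.length →
      brace K x y w (p ::ₘ ν) = braceOp K x y w ν (x p))
    (p q : L) {ν : Multiset L} (hν : Multiset.card ν + 1 = w.length) :
    braceOp K x y (a :: w) (p ::ₘ ν) (x q) = braceOp K x y (a :: w) (q ::ₘ ν) (x p) := by
  -- The summand of the recursion that removes `p` cancels the term `r * rmul K a (x p)` of the
  -- Leibniz rule. What remains is the left-symmetry defect and a sum over `q ::ₘ p ::ₘ τ`, both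
  -- symmetric in `p` and `q`.
  have key : ∀ p q : L, braceOp K x y (a :: w) (p ::ₘ ν) (x q) =
      (op (K := K) a (x p) (braceOp K x y w ν (x q)) -
        braceOp K x y w ν (op (K := K) a (x p) (x q))) -
      ν.eraseSum fun k τ => rmul K a (x k) (brace K x y w (q ::ₘ p ::ₘ τ)) := by
    intro p q
    rw [braceOp_cons, ih p ν hν, rmul_rightAlgebra_apply (braceOp_mem K x y w ν),
      Multiset.eraseSum_cons,
      rightAlgebra_commute (rmul_mem K a (x p)) (braceOp_mem K x y w ν), ← sub_sub,
      add_sub_cancel_right, LinearMap.sub_apply, LinearMap.sub_apply]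
    congr 1
    change LinearMap.applyₗ (R := K) (x q) _ = _
    rw [Multiset.map_eraseSum]
    refine Multiset.eraseSum_congr fun k τ hk => ?_
    rw [ih q (p ::ₘ τ) (by rw [← hν, ← hk]; simp)]
    rfl
  rw [key, key, op_rightAlgebra_symm (braceOp_mem K x y w ν)]
  simp only [Multiset.cons_swap p q]

lemma brace_cons (w : List A) (p : L) {ν : Multiset L} (hν : Multiset.card ν + 1 = w.length) :
    brace K x y w (p ::ₘ ν) = braceOp K x y w ν (x p) := by
  induction w generalizing p ν with
  | nil => simp at hν
  | cons a w ih =>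
    obtain ⟨q, ν', h, h'⟩ := exists_brace_cons K x y a w (Multiset.cons_ne_zero (a := p) (m := ν))
    rw [h']
    obtain ⟨rfl, rfl⟩ | ⟨-, τ, rfl, rfl⟩ := Multiset.cons_eq_cons.1 h
    · rfl
    · exact braceOp_exchange_of_brace K x y a w (fun p ν h => ih p h) p q (by simpa using hν)

lemma braceOp_exchange (w : List A) (p q : L) {ν : Multiset L}
    (hν : Multiset.card ν + 2 = w.length) :
    braceOp K x y w (p ::ₘ ν) (x q) = braceOp K x y w (q ::ₘ ν) (x p) := by
  rw [← brace_cons K x y w q (by simpa using hν), ← brace_cons K x y w p (by simpa using hν),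
    Multiset.cons_swap]

lemma op_op_sub_index_symm (a b : A) (p q z : N) :
    op (K := K) a p (op (K := K) b q z) - op (K := K) b (op (K := K) a p q) z =
      op (K := K) b p (op (K := K) a q z) - op (K := K) a (op (K := K) b p q) z := by
  rw [← neg_sub, assoc_index_symm, neg_sub]

/-- This is `D^a D^b = D^b D^a`. After both recursion steps are expanded, index symmetry and right
commutativity match the terms. -/
lemma braceOp_swap (a b : A) (w : List A) {μ : Multiset L} (hμ : Multiset.card μ = w.length + 1) :
    braceOp K x y (a :: b :: w) μ = braceOp K x y (b :: a :: w) μ := by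
  obtain ⟨p, ν, rfl⟩ := Multiset.card_pos_iff_exists_mem.1 (by omega : 0 < Multiset.card μ)
    |>.imp fun p hp => Multiset.exists_cons_of_mem hp
  have hν : Multiset.card ν = w.length := by simpa using hμ
  ext X
  have apply_sum : ∀ (X : N) (τ : Multiset L) (g : L → Multiset L → Module.End K N),
      τ.eraseSum g X = τ.eraseSum fun q σ => g q σ X := fun X τ g =>
    Multiset.map_eraseSum (LinearMap.applyₗ (R := K) X) τ g
  have hG : ∀ c : A, brace K x y (c :: w) (p ::ₘ ν) = op (K := K) c (x p) (brace K x y w ν) -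
      ν.eraseSum fun q τ => op (K := K) c (brace K x y w (p ::ₘ τ)) (x q) := by
    intro c
    rw [brace_cons K x y (c :: w) p (by simpa using hν), braceOp_cons, LinearMap.sub_apply,
      apply_sum]
    refine congrArg _ (Multiset.eraseSum_congr fun q τ h => ?_)
    rw [brace_cons K x y w p (by rw [← hν, ← h]; simp)]
    rfl
  -- A product of the form `(X ▷_a G) ▷_b x_q` is subtracted and added. The resulting associators
  -- are symmetric in `a` and `b`; right commutativity exchanges the two terms of the other group,
  -- and fixes the double sum once `q` and `q'` are interchanged.
  have key : ∀ a b : A, braceOp K x y (a :: b :: w) (p ::ₘ ν) X =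
      (op (K := K) a X (op (K := K) b (x p) (brace K x y w ν)) -
        op (K := K) b (op (K := K) a X (x p)) (brace K x y w ν)) -
      (ν.eraseSum fun q τ =>
        (op (K := K) a X (op (K := K) b (brace K x y w (p ::ₘ τ)) (x q)) -
          op (K := K) b (op (K := K) a X (brace K x y w (p ::ₘ τ))) (x q)) +
        (op (K := K) b (op (K := K) a X (brace K x y w (p ::ₘ τ))) (x q) +
          op (K := K) b (op (K := K) a X (x q)) (brace K x y w (p ::ₘ τ)))) +
      (p ::ₘ ν).eraseSum fun q τ => τ.eraseSum fun q' σ =>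
        op (K := K) b (op (K := K) a (braceOp K x y w σ X) (x q)) (x q') := by
    intro a b
    rw [braceOp_cons, LinearMap.sub_apply, hG, apply_sum]
    have h1 : ((p ::ₘ ν).eraseSum fun q τ => (rmul K a (x q) * braceOp K x y (b :: w) τ) X) =
        ((p ::ₘ ν).eraseSum fun q τ => op (K := K) b (op (K := K) a X (x q)) (brace K x y w τ)) -
        (p ::ₘ ν).eraseSum fun q τ => τ.eraseSum fun q' σ =>
          op (K := K) b (op (K := K) a (braceOp K x y w σ X) (x q)) (x q') := by
      rw [eq_sub_iff_add_eq, ← Multiset.eraseSum_add]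
      refine Multiset.eraseSum_congr fun q τ _ => ?_
      rw [Module.End.mul_apply, ← rightAlgebra_apply_comm (braceOp_mem K x y (b :: w) τ)
        (rmul_mem K a (x q)), braceOp_cons, LinearMap.sub_apply, apply_sum, rmul_apply, rmul_apply,
        sub_add_eq_add_sub, add_sub_assoc, add_eq_left, sub_eq_zero]
      refine Multiset.eraseSum_congr fun q' σ _ => ?_
      rw [← rightAlgebra_apply_op (braceOp_mem K x y w σ)]
      rfl
    rw [h1, Multiset.eraseSum_cons, rmul_apply, map_sub, Multiset.map_eraseSum]
    have h2 : ∀ a b c : N, a - c + (c + b) = a + b := fun a b c => by abel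
    simp only [h2, Multiset.eraseSum_add]
    abel
  rw [key, key, op_op_sub_index_symm K a b, Multiset.eraseSum_comm (p ::ₘ ν)]
  refine congrArg₂ _ (congrArg _ (Multiset.eraseSum_congr fun q τ _ => ?_)) ?_
  · rw [op_op_sub_index_symm K a b, right_comm a b X (x q), right_comm b a X (x q)]
    congr 1
    exact add_comm _ _
  · simp only [right_comm a b]

end MultiNovikovAlgebra

lemma Multiset.exists_le_card_eq {L : Type*} {μ : Multiset L} {n : ℕ}
    (h : n ≤ Multiset.card μ) : ∃ ν ≤ μ, Multiset.card ν = n := by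
  obtain ⟨ν, hν⟩ := Multiset.card_pos_iff_exists_mem.1
    (by rw [Multiset.card_powersetCard]; exact Nat.choose_pos h :
      0 < Multiset.card (Multiset.powersetCard n μ))
  exact ⟨ν, Multiset.mem_powersetCard.1 hν⟩

/-! ### Commutativity of words, and the span of the braces -/

namespace MultiNovikovAlgebra

variable (K : Type*) {A N L : Type*} [Field K] [AddCommGroup N] [Module K N]
  [MultiNovikovAlgebra K A N] [DecidableEq L] (x : L → N)

lemma braceOp_perm (y : N) {w w' : List A} (h : w.Perm w') {μ : Multiset L}
    (hμ : Multiset.card μ + 1 = w.length) : braceOp K x y w μ = braceOp K x y w' μ := by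
  induction h generalizing μ with
  | nil => rfl
  | cons a h ih =>
    rename_i w w'
    have hμ : Multiset.card μ = w.length := by simpa using hμ
    have hG : brace K x y w μ = brace K x y w' μ := by
      induction μ using Multiset.induction with
      | empty =>
        obtain rfl : w = [] := List.length_eq_zero_iff.1 (by simpa using hμ.symm)
        rw [List.nil_perm.1 h]
      | cons p ν _ =>
        have hν : Multiset.card ν + 1 = w.length := by simpa using hμ
        rw [brace_cons K x y w p hν, brace_cons K x y w' p (h.length_eq ▸ hν), ih hν]
    rw [braceOp_cons, braceOp_cons, hG]
    congr 1
    refine Multiset.eraseSum_congr fun q τ hq => ?_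
    rw [ih (by rw [← hμ, ← hq]; simp)]
  | swap a b w => exact braceOp_swap K x y b a w (by simpa using hμ)
  | trans h _ ih1 ih2 => rw [ih1 hμ, ih2 (h.length_eq ▸ hμ)]

variable (A) in
/-- The multiplication operators `braceOp` attached to generators. -/
def braceOps : Set (Module.End K N) :=
  {r | ∃ (l : L) (w : List A) (ν : Multiset L),
    Multiset.card ν + 1 = w.length ∧ braceOp K x (x l) w ν = r}

lemma rmul_mem_adjoin_braceOps (a : A) (l : L) :
    rmul K a (x l) ∈ Algebra.adjoin K (braceOps K A x) :=
  Algebra.subset_adjoin ⟨l, [a], 0, rfl, braceOp_singleton K x (x l) a⟩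

lemma adjoin_braceOps_le : Algebra.adjoin K (braceOps K A x) ≤ rightAlgebra K A N := by
  refine Algebra.adjoin_le ?_
  rintro _ ⟨l, w, ν, -, rfl⟩
  exact braceOp_mem K x (x l) w ν

/-- The commutator with `op a (x p)` is a derivation, so generators suffice. On a brace it plays the
role of `x p * D^a`, and the recursion read backwards expresses it by a brace with one more letter
and one more argument, plus products of braces. -/
lemma commutator_mem_adjoin_braceOps (a : A) (p : L) {r : Module.End K N}
    (hr : r ∈ Algebra.adjoin K (braceOps K A x)) :
    op (K := K) a (x p) * r - r * op (K := K) a (x p) ∈ Algebra.adjoin K (braceOps K A x) := by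
  induction hr using Algebra.adjoin_induction with
  | mem r hr =>
    obtain ⟨l, w, ν, hν, rfl⟩ := hr
    have h := rmul_rightAlgebra_apply (braceOp_mem K x (x l) w ν) a (x p)
    rw [← sub_eq_iff_eq_add, ← brace_cons K x (x l) w p hν,
      sub_eq_iff_eq_add.1 (braceOp_cons K x (x l) a w (p ::ₘ ν)).symm] at h
    rw [← h]
    have hmem : ∀ τ : Multiset L, Multiset.card τ + 1 = w.length →
        braceOp K x (x l) w τ ∈ Algebra.adjoin K (braceOps K A x) := fun τ hτ =>
      Algebra.subset_adjoin ⟨l, w, τ, hτ, rfl⟩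
    refine sub_mem (add_mem (Algebra.subset_adjoin ⟨l, a :: w, p ::ₘ ν, by simpa using hν, rfl⟩)
      (multiset_sum_mem _ fun s hs => ?_)) (mul_mem (hmem _ hν) (rmul_mem_adjoin_braceOps K x a p))
    obtain ⟨q, hq, rfl⟩ := Multiset.mem_map.1 hs
    refine mul_mem (rmul_mem_adjoin_braceOps K x a q) (hmem _ ?_)
    rw [Multiset.card_erase_add_one hq, Multiset.card_cons, hν]
  | algebraMap c => simp [Algebra.commutes]
  | add r s _ _ h1 h2 =>
    rw [mul_add, add_mul, add_sub_add_comm]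
    exact add_mem h1 h2
  | mul r s hr hs h1 h2 =>
    have : op (K := K) a (x p) * (r * s) - r * s * op (K := K) a (x p) =
        (op (K := K) a (x p) * r - r * op (K := K) a (x p)) * s +
          r * (op (K := K) a (x p) * s - s * op (K := K) a (x p)) := by
      noncomm_ring
    rw [this]
    exact add_mem (mul_mem h1 hs) (mul_mem hr h2)

variable (A) in
/-- The span of the generators under the algebra generated by the `braceOps`. -/
def braceSpan : Submodule K N :=
  Submodule.span K {z | ∃ (l : L) (r : Module.End K N),
    r ∈ Submonoid.closure (braceOps K A x) ∧ r (x l) = z}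

lemma apply_mem_braceSpan {r : Module.End K N} (hr : r ∈ Algebra.adjoin K (braceOps K A x))
    (l : L) : r (x l) ∈ braceSpan K A x := by
  rw [← Subalgebra.mem_toSubmodule, Algebra.adjoin_eq_span] at hr
  induction hr using Submodule.span_induction with
  | mem r hr => exact Submodule.subset_span ⟨l, r, hr, rfl⟩
  | zero => exact zero_mem _
  | add r s _ _ h1 h2 => exact add_mem h1 h2
  | smul c r _ h => exact Submodule.smul_mem _ c h

/-- For `q = s (x m)`, right multiplication by `q` is, by the Leibniz rule, a commutator with `op a
(x m)` plus `s * rmul K a (x m)`, both in the algebra generated by the braces. -/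
lemma op_mem_braceSpan (a : A) {p q : N} (hp : p ∈ braceSpan K A x) (hq : q ∈ braceSpan K A x) :
    op (K := K) a p q ∈ braceSpan K A x := by
  have hle : (Submonoid.closure (braceOps K A x) : Set (Module.End K N)) ⊆
      Algebra.adjoin K (braceOps K A x) :=
    Submonoid.closure_le (S := (Algebra.adjoin K (braceOps K A x)).toSubmonoid) |>.2
      Algebra.subset_adjoin
  rw [braceSpan] at hp hq
  induction hp using Submodule.span_induction with
  | zero => simp
  | add _ _ _ _ h1 h2 => simpa using add_mem h1 h2
  | smul c _ _ h => simpa using Submodule.smul_mem _ c h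
  | mem p hp =>
    induction hq using Submodule.span_induction with
    | zero => simp
    | add _ _ _ _ h1 h2 => simpa using add_mem h1 h2
    | smul c _ _ h => simpa using Submodule.smul_mem _ c h
    | mem q hq =>
      obtain ⟨l, r, hr, rfl⟩ := hp
      obtain ⟨m, s, hs, rfl⟩ := hq
      rw [← rmul_apply, rmul_rightAlgebra_apply (adjoin_braceOps_le K x (hle hs)),
        ← Module.End.mul_apply]
      exact apply_mem_braceSpan K x (mul_mem (add_mem
        (commutator_mem_adjoin_braceOps K x a m (hle hs))
        (mul_mem (hle hs) (rmul_mem_adjoin_braceOps K x a m))) (hle hr)) l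

/-! ### Products of braces -/

/-- `IsBraceProd K x S τ r` says that `r` is a product of the operators `braceOp` attached to the
pairs of a generator and a commutative word in the list `S`, with total set of arguments `τ`. -/
inductive IsBraceProd : List (L × (A →₀ ℕ)) → Multiset L → Module.End K N → Prop
  | nil : IsBraceProd [] 0 1
  | cons (v : L × (A →₀ ℕ)) {S : List (L × (A →₀ ℕ))} (ν : Multiset L) {τ : Multiset L}
      {r : Module.End K N} : Multiset.card ν + 1 = v.2.degree → IsBraceProd S τ r →
      IsBraceProd (v :: S) (ν + τ) (braceOp K x (x v.1) v.2.toMultiset.toList ν * r)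

variable {K x}

lemma length_toList_toMultiset (w : A →₀ ℕ) : w.toMultiset.toList.length = w.degree := by
  rw [Multiset.length_toList, Finsupp.card_toMultiset, Finsupp.degree_apply]
  rfl

namespace IsBraceProd

lemma mem_rightAlgebra {S : List (L × (A →₀ ℕ))} {τ : Multiset L} {r : Module.End K N}
    (h : IsBraceProd K x S τ r) : r ∈ rightAlgebra K A N := by
  induction h with
  | nil => exact one_mem _
  | cons v ν _ _ ih => exact mul_mem (braceOp_mem K x _ _ ν) ih

lemma ne_zero {S : List (L × (A →₀ ℕ))} {τ : Multiset L} {r : Module.End K N}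
    (h : IsBraceProd K x S τ r) {v : L × (A →₀ ℕ)} (hv : v ∈ S) : v.2 ≠ 0 := by
  induction h with
  | nil => simp at hv
  | cons v' ν hν _ ih =>
    obtain rfl | hv := List.mem_cons.1 hv
    · intro h0
      simp [h0] at hν
    · exact ih hv

lemma card_add_length {S : List (L × (A →₀ ℕ))} {τ : Multiset L} {r : Module.End K N}
    (h : IsBraceProd K x S τ r) :
    Multiset.card τ + S.length = (S.map fun v => v.2.degree).sum := by
  induction h with
  | nil => rfl
  | cons v ν hν _ ih =>
    simp only [Multiset.card_add, List.length_cons, List.map_cons, List.sum_cons]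
    omega

-- A nonempty word `w` takes exactly `|w| - 1` arguments, so when the total is right the arguments
-- can be dealt out greedily.
variable (K x) in
lemma exists_of_card (S : List (L × (A →₀ ℕ))) (hS : ∀ v ∈ S, v.2 ≠ 0) (τ : Multiset L)
    (hτ : Multiset.card τ + S.length = (S.map fun v => v.2.degree).sum) :
    ∃ r, IsBraceProd K x S τ r := by
  induction S generalizing τ with
  | nil =>
    obtain rfl : τ = 0 := by simpa using hτ
    exact ⟨1, nil⟩
  | cons v S ih =>
    have hle : S.length ≤ (S.map fun v => v.2.degree).sum := by
      have := List.card_nsmul_le_sum (S.map fun v => v.2.degree) 1 fun n hn => by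
        obtain ⟨v, hv, rfl⟩ := List.mem_map.1 hn
        exact Nat.one_le_iff_ne_zero.2 fun h => hS v (List.mem_cons_of_mem _ hv)
          ((Finsupp.degree_eq_zero_iff _).1 h)
      simpa using this
    have hv : v.2.degree ≠ 0 := fun h => hS v List.mem_cons_self
      ((Finsupp.degree_eq_zero_iff _).1 h)
    simp only [List.length_cons, List.map_cons, List.sum_cons] at hτ
    obtain ⟨ν, hντ, hν⟩ := Multiset.exists_le_card_eq (μ := τ) (n := v.2.degree - 1) (by omega)
    obtain ⟨τ', rfl⟩ := Multiset.le_iff_exists_add.1 hντ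
    rw [Multiset.card_add] at hτ
    obtain ⟨r, hr⟩ := ih (fun v hv => hS v (List.mem_cons_of_mem _ hv)) τ' (by omega)
    exact ⟨_, cons v ν (by omega) hr⟩

lemma exists_of_card_eq {S : List (L × (A →₀ ℕ))} {τ : Multiset L} {r : Module.End K N}
    (h : IsBraceProd K x S τ r) {τ' : Multiset L} (hτ : Multiset.card τ' = Multiset.card τ) :
    ∃ r', IsBraceProd K x S τ' r' :=
  exists_of_card K x S (fun _ hv => h.ne_zero hv) τ' (hτ ▸ h.card_add_length)

lemma append {S S' : List (L × (A →₀ ℕ))} {τ τ' : Multiset L} {r r' : Module.End K N}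
    (h : IsBraceProd K x S τ r) (h' : IsBraceProd K x S' τ' r') :
    IsBraceProd K x (S ++ S') (τ + τ') (r * r') := by
  induction h with
  | nil => simpa using h'
  | cons v ν hν _ ih =>
    rw [add_assoc, mul_assoc]
    exact cons v ν hν ih

lemma perm {S S' : List (L × (A →₀ ℕ))} (hS : S.Perm S') {τ : Multiset L} {r : Module.End K N}
    (h : IsBraceProd K x S τ r) : IsBraceProd K x S' τ r := by
  induction hS generalizing τ r with
  | nil => exact h
  | cons v _ ih =>
    cases h with
    | cons _ ν hν h => exact cons v ν hν (ih h)
  | swap u v S =>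
    cases h with
    | cons _ ν hν h =>
      cases h with
      | cons _ ν' hν' h =>
        rw [← mul_assoc, rightAlgebra_commute (braceOp_mem K x _ _ ν) (braceOp_mem K x _ _ ν'),
          mul_assoc, add_left_comm]
        exact cons u ν' hν' (cons v ν hν h)
  | trans _ _ ih1 ih2 => exact ih2 (ih1 h)

/-- The value at a generator of a product of braces only depends on the set of all arguments. -/
lemma apply_eq {S : List (L × (A →₀ ℕ))} {τ τ' : Multiset L} {r r' : Module.End K N}
    (h : IsBraceProd K x S τ r) (h' : IsBraceProd K x S τ' r') {l l' : L}
    (hl : l ::ₘ τ = l' ::ₘ τ') : r (x l) = r' (x l') := by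
  induction S generalizing τ τ' r r' l l' with
  | nil =>
    cases h
    cases h'
    rw [Multiset.cons_zero, Multiset.cons_zero, Multiset.singleton_inj] at hl
    rw [hl]
  | cons v S ih =>
    obtain ⟨y, w⟩ := v
    -- The arguments `a` of the head brace are traded one by one for the arguments `b` found outside
    -- it; `c` and `t` stay in place.
    have key : ∀ (a b c t : Multiset L), Multiset.card a = Multiset.card b →
        Multiset.card (c + a) + 1 = w.degree →
        ∀ {τ τ' : Multiset L} {r r' : Module.End K N} {l l' : L},
        IsBraceProd K x S τ r → IsBraceProd K x S τ' r' → l ::ₘ τ = b + t → l' ::ₘ τ' = a + t →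
        braceOp K x (x y) w.toMultiset.toList (c + a) (r (x l)) =
          braceOp K x (x y) w.toMultiset.toList (c + b) (r' (x l')) := by
      intro a
      induction a using Multiset.induction with
      | empty =>
        intro b c t hab _ τ τ' r r' l l' h h' hl hl'
        obtain rfl : b = 0 := by simpa using hab.symm
        rw [ih h h' (hl.trans hl'.symm)]
      | cons p a ih' =>
        intro b c t hab hc τ τ' r r' l l' h h' hl hl'
        obtain ⟨q, hq⟩ := Multiset.card_pos_iff_exists_mem.1
          (by rw [← hab]; simp : 0 < Multiset.card b)
        obtain ⟨b, rfl⟩ := Multiset.exists_cons_of_mem hq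
        have hab : Multiset.card a = Multiset.card b := by simpa using hab
        have hτ' : Multiset.card (a + t) = Multiset.card τ' := by
          simpa using (congrArg Multiset.card hl').symm
        -- An intermediate tail `r₁` applied to `x q`. It commutes with the head, so `q` can be
        -- exchanged there with `p`; the tail is then rearranged by the outer induction.
        obtain ⟨r₁, h₁⟩ := h'.exists_of_card_eq hτ'
        have hc' : Multiset.card ((p ::ₘ c) + a) + 1 = w.degree := by
          rw [← hc]
          simp
        have e1 := ih' b (p ::ₘ c) (q ::ₘ t) hab hc' h h₁ (by rw [hl]; simp) (l' := q) (by simp)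
        have e2 := ih h₁ h' (l := p) (l' := l') (by rw [hl']; simp)
        have hb : Multiset.card (c + b) + 2 = w.toMultiset.toList.length := by
          rw [length_toList_toMultiset, ← hc, Multiset.card_add, Multiset.card_add,
            Multiset.card_cons, hab]
          omega
        rw [Multiset.cons_add, Multiset.cons_add] at e1
        rw [Multiset.add_cons, Multiset.add_cons, e1,
          ← rightAlgebra_apply_comm h₁.mem_rightAlgebra (braceOp_mem K x _ _ _),
          braceOp_exchange K x _ _ p q hb,
          rightAlgebra_apply_comm h₁.mem_rightAlgebra (braceOp_mem K x _ _ _), e2]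
    cases h with
    | @cons _ _ ν τ r hν h =>
      cases h' with
      | @cons _ _ ν' τ' r' hν' h' =>
        have hc : ∀ s t : Multiset L, s ∩ t + (s - t) = s := fun s t => by
          rw [add_comm, Multiset.sub_add_inter]
        have e1 := hc ν ν'
        have e2 := hc ν' ν
        rw [Multiset.inter_comm] at e2
        have hl' : (ν - ν') + (l ::ₘ τ) = (ν' - ν) + (l' ::ₘ τ') := by
          apply add_left_cancel (a := ν ∩ ν')
          rw [← add_assoc, e1, ← add_assoc, e2, Multiset.add_cons, hl, Multiset.add_cons]
        -- The two heads differ by disjoint multisets, so what the second head has in excess must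
        -- lie in the first tail or its generator.
        have hle : ν' - ν ≤ l ::ₘ τ := by
          have hd : Disjoint (ν' - ν) (ν - ν') := by
            rw [Multiset.disjoint_left]
            intro q h1 h2
            have h3 := Multiset.mem_sub.1 h1
            have h4 := Multiset.mem_sub.1 h2
            omega
          refine Multiset.le_iff_count.2 fun q => ?_
          have h1 := congrArg (Multiset.count q) hl'
          rw [Multiset.count_add, Multiset.count_add, Multiset.count_sub, Multiset.count_sub] at h1
          rw [Multiset.count_sub]
          omega
        obtain ⟨t, ht⟩ := Multiset.le_iff_exists_add.1 hle
        have ht' : l' ::ₘ τ' = (ν - ν') + t := by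
          apply add_left_cancel (a := ν' - ν)
          rw [← hl', ht, add_left_comm]
        have := key (ν - ν') (ν' - ν) (ν ∩ ν') t
          (by
            have h1 := congrArg Multiset.card e1
            have h2 := congrArg Multiset.card e2
            rw [Multiset.card_add] at h1 h2
            simp only at hν hν'
            omega)
          (by rw [e1]; exact hν) h h' ht ht'
        rw [e1, e2] at this
        exact this

end IsBraceProd

variable (K x) in
lemma exists_isBraceProd {r : Module.End K N} (hr : r ∈ Submonoid.closure (braceOps K A x)) :
    ∃ S τ, IsBraceProd K x (A := A) S τ r := by
  classical
  induction hr using Submonoid.closure_induction with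
  | one => exact ⟨[], 0, .nil⟩
  | mul r s _ _ h1 h2 =>
    obtain ⟨S, τ, h⟩ := h1
    obtain ⟨S', τ', h'⟩ := h2
    exact ⟨_, _, h.append h'⟩
  | mem r hr =>
    obtain ⟨l, w, ν, hν, rfl⟩ := hr
    -- `IsBraceProd` uses the order of letters chosen by `toList`; `braceOp_perm` absorbs the
    -- difference with `w`.
    have hp : (Multiset.toFinsupp (w : Multiset A)).toMultiset.toList.Perm w := by
      rw [← Multiset.coe_eq_coe, Multiset.coe_toList, Multiset.toFinsupp_toMultiset]
    refine ⟨[(l, Multiset.toFinsupp (w : Multiset A))], ν + 0, ?_⟩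
    rw [← mul_one (braceOp K x (x l) w ν), ← braceOp_perm K x (x l) hp (by rw [hν, hp.length_eq])]
    exact .cons _ ν (by rw [hν, ← hp.length_eq, length_toList_toMultiset]) .nil

end MultiNovikovAlgebra

/-! ### Images of braces in the polynomial algebra -/

namespace GeneralMultiIndex

open MvPolynomial MultiNovikovAlgebra

variable {K : Type*} [Field K] {d : ℕ} {L : Type*}

lemma prod_map_X (m : Multiset (Var d L)) [DecidableEq (Var d L)] :
    (m.map (X : Var d L → Poly K d L)).prod = monomial (Multiset.toFinsupp m) 1 := by
  induction m using Multiset.induction with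
  | empty => simp
  | cons v m ih =>
    rw [Multiset.map_cons, Multiset.prod_cons, ih, ← Multiset.singleton_add, map_add,
      Multiset.toFinsupp_singleton, X, monomial_mul, one_mul]

lemma derivation_multiset_prod [DecidableEq L] (n : Letter d) (f : L → Poly K d L)
    (μ : Multiset L) : D K n (μ.map f).prod =
      μ.eraseSum fun q τ => (τ.map f).prod * D K n (f q) := by
  induction μ using Multiset.induction with
  | empty => simp
  | cons p ν ih =>
    simp only [Multiset.eraseSum_cons, Multiset.map_cons, Multiset.prod_cons, Derivation.leibniz,
      ih, smul_eq_mul, mul_assoc]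
    rw [add_comm, Multiset.mul_eraseSum]

variable (K) in
/-- The iterated derivation along a word. -/
def iterD (w : List (Letter d)) (p : Poly K d L) : Poly K d L :=
  w.foldr (fun n q => D K n q) p

/-- The constant is the product of the factorials of the multiplicities of the letters, nonzero
because the characteristic is `0`. -/
lemma exists_iterD_X [CharZero K] (l : L) (w : List (Letter d)) :
    ∃ c : K, c ≠ 0 ∧ iterD K w (X (l, 0)) =
      c • X (l, Multiset.toFinsupp (w : Multiset (Letter d))) := by
  induction w with
  | nil => exact ⟨1, one_ne_zero, by simp [iterD]⟩
  | cons n w ih =>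
    obtain ⟨c, hc, h⟩ := ih
    refine ⟨c * ((Multiset.toFinsupp (w : Multiset (Letter d)) n + 1 : ℕ) : K),
      mul_ne_zero hc (Nat.cast_ne_zero.2 (Nat.succ_ne_zero _)), ?_⟩
    change D K n (iterD K w (X (l, 0))) = _
    rw [h, Derivation.map_smul, D, mkDerivation_X, ← Nat.cast_smul_eq_nsmul K, smul_smul,
      ← Multiset.cons_coe,   ← Multiset.singleton_add, map_add, Multiset.toFinsupp_singleton, add_comm (Finsupp.single n 1)]

lemma weight_eq_sum (β : Var d L →₀ ℕ) :
    weight β = (β.toMultiset.map fun v => 1 - (v.2.degree : ℤ)).sum := by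
  induction β using Finsupp.induction_linear with
  | zero => simp
  | add β γ h1 h2 => simp only [map_add, h1, h2, Multiset.map_add, Multiset.sum_add]
  | single v k => simp [weight_single, Finsupp.toMultiset_single, Multiset.map_nsmul,
      Multiset.sum_nsmul, mul_comm]

section Hom

variable {N : Type*} [AddCommGroup N] [Module K N] [MultiNovikovAlgebra K (Letter d) N]
  [DecidableEq L] {x : L → N} {φ : N →ₗ[K] Poly K d L}
  (hφ : ∀ (n : Letter d) (p q : N),
    φ (MultiNovikovAlgebra.op (K := K) n p q) = φ p * D K n (φ q))
  (hx : ∀ l, φ (x l) = X (l, 0))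

include hφ hx

/-- Right products go to multiplications by derivatives, so the correction sum in the recursion
cancels exactly the Leibniz terms in which the arguments are differentiated. -/
lemma map_brace_and_braceOp (y : N) (w : List (Letter d)) :
    (∀ μ : Multiset L, Multiset.card μ = w.length → φ (brace K x y w μ) =
      (μ.map fun q => X (q, 0)).prod * iterD K w (φ y)) ∧
    ∀ (μ : Multiset L) (p : N), Multiset.card μ + 1 = w.length → φ (braceOp K x y w μ p) =
      φ p * ((μ.map fun q => X (q, 0)).prod * iterD K w (φ y)) := by
  induction w with
  | nil =>
    refine ⟨fun μ hμ => ?_, fun μ p hμ => by simp at hμ⟩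
    obtain rfl : μ = 0 := by simpa using hμ
    simp [brace_nil, iterD]
  | cons n w ih =>
    have h2 : ∀ (μ : Multiset L) (p : N), Multiset.card μ + 1 = (n :: w).length →
        φ (braceOp K x y (n :: w) μ p) =
          φ p * ((μ.map fun q => X (q, 0)).prod * iterD K (n :: w) (φ y)) := by
      intro μ p hμ
      have hμ : Multiset.card μ = w.length := by simpa using hμ
      have h3 : (μ.eraseSum fun q τ => rmul K n (x q) * braceOp K x y w τ) p =
          μ.eraseSum fun q τ => (rmul K n (x q) * braceOp K x y w τ) p :=
        Multiset.map_eraseSum (LinearMap.applyₗ (R := K) p) μ _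
      have h4 : φ (μ.eraseSum fun q τ => (rmul K n (x q) * braceOp K x y w τ) p) =
          φ p * (iterD K w (φ y) * D K n (μ.map fun q => X (q, 0)).prod) := by
        rw [Multiset.map_eraseSum, derivation_multiset_prod, Multiset.mul_eraseSum,
          Multiset.mul_eraseSum]
        refine Multiset.eraseSum_congr fun q τ h => ?_
        rw [Module.End.mul_apply, rmul_apply, hφ, ih.2 τ p (by rw [← hμ, ← h]; simp), hx]
        ring
      rw [braceOp_cons, LinearMap.sub_apply, map_sub, h3, h4, rmul_apply, hφ, ih.1 μ hμ,
        Derivation.leibniz, smul_eq_mul, smul_eq_mul, ← mul_sub, add_sub_cancel_right]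
      rfl
    refine ⟨fun μ hμ => ?_, h2⟩
    obtain ⟨p, hp⟩ := Multiset.card_pos_iff_exists_mem.1 (by simp [hμ] : 0 < Multiset.card μ)
    obtain ⟨ν, rfl⟩ := Multiset.exists_cons_of_mem hp
    have hν : Multiset.card ν + 1 = (n :: w).length := by simpa using hμ
    rw [brace_cons K x y _ p hν, h2 ν _ hν, hx, Multiset.map_cons, Multiset.prod_cons, mul_assoc]

lemma exists_map_isBraceProd [CharZero K] {S : List (Var d L)} {τ : Multiset L}
    {r : Module.End K N} (h : IsBraceProd K x S τ r) :
    ∃ c : K, c ≠ 0 ∧ ∀ p, φ (r p) =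
      c • (φ p * (((τ.map fun q => (q, 0)) + (S : Multiset (Var d L))).map X).prod) := by
  induction h with
  | nil => exact ⟨1, one_ne_zero, by simp⟩
  | @cons v S ν τ r hν _ ih =>
    obtain ⟨c, hc, h⟩ := ih
    obtain ⟨c', hc', h'⟩ := exists_iterD_X (K := K) v.1 v.2.toMultiset.toList
    refine ⟨c * c', mul_ne_zero hc hc', fun p => ?_⟩
    rw [Module.End.mul_apply, (map_brace_and_braceOp hφ hx (x v.1) _).2 ν _
      (by rw [length_toList_toMultiset, hν]), h, hx, h', Multiset.coe_toList,
      Finsupp.toMultiset_toFinsupp, mul_smul, ← Multiset.cons_coe]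
    simp only [Multiset.map_add, Multiset.map_cons, Multiset.prod_add, Multiset.prod_cons,
      Multiset.map_map, Function.comp_def, Algebra.smul_mul_assoc, Algebra.mul_smul_comm]
    rw [smul_comm]
    refine congrArg _ (congrArg _ ?_)
    change _ = _ * (_ * (X (v.1, v.2) * (Multiset.map X (S : Multiset (Var d L))).prod))
    ring

end Hom

/-! ### Brace monomials attached to a multi-index -/

variable (K) in
/-- `IsBraceMonomial K x β z` says that `z` is the value at a generator of a product of braces whose
variables are those of the multi-index `β`. -/
def IsBraceMonomial {N : Type*} [AddCommGroup N] [Module K N] [MultiNovikovAlgebra K (Letter d) N]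
    [DecidableEq L] (x : L → N) (β : Var d L →₀ ℕ) (z : N) : Prop :=
  ∃ (S : List (Var d L)) (τ : Multiset L) (r : Module.End K N) (l : L), IsBraceProd K x S τ r ∧
    r (x l) = z ∧ (l ::ₘ τ).map (fun q => (q, 0)) + (S : Multiset (Var d L)) = β.toMultiset

section Hom

variable {N : Type*} [AddCommGroup N] [Module K N] [MultiNovikovAlgebra K (Letter d) N]
  [DecidableEq L] {x : L → N} {φ : N →ₗ[K] Poly K d L}

/-- The variables of `β` with empty word are the generator and the arguments; the others form `S` up
to order. So `perm` and `apply_eq` apply. -/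
lemma IsBraceMonomial.unique {β : Var d L →₀ ℕ} {z z' : N} (h : IsBraceMonomial K x β z)
    (h' : IsBraceMonomial K x β z') : z = z' := by
  obtain ⟨S, τ, r, l, hr, rfl, hβ⟩ := h
  obtain ⟨S', τ', r', l', hr', rfl, hβ'⟩ := h'
  have key : ∀ {S : List (Var d L)} {τ : Multiset L} {r : Module.End K N} {l : L},
      IsBraceProd K x S τ r →
      (l ::ₘ τ).map (fun q => (q, 0)) + (S : Multiset (Var d L)) = β.toMultiset →
      (l ::ₘ τ).map (fun q => (q, 0)) = β.toMultiset.filter (fun v => v.2 = 0) ∧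
      (S : Multiset (Var d L)) = β.toMultiset.filter (fun v => ¬ v.2 = 0) := by
    intro S τ r l hr hβ
    have h1 : ∀ v ∈ (l ::ₘ τ).map (fun q => ((q, 0) : Var d L)), v.2 = 0 := by
      intro v hv
      obtain ⟨q, -, rfl⟩ := Multiset.mem_map.1 hv
      rfl
    have h2 : ∀ v ∈ (S : Multiset (Var d L)), ¬ v.2 = 0 := fun v hv => hr.ne_zero hv
    rw [← hβ, Multiset.filter_add, Multiset.filter_add, Multiset.filter_eq_self.2 h1,
      Multiset.filter_eq_self.2 h2, Multiset.filter_eq_nil.2 h2,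
      Multiset.filter_eq_nil.2 fun v hv => not_not.2 (h1 v hv), add_zero, zero_add]
    exact ⟨rfl, rfl⟩
  obtain ⟨k1, k2⟩ := key hr hβ
  obtain ⟨k1', k2'⟩ := key hr' hβ'
  have hS : S.Perm S' := Multiset.coe_eq_coe.1 (k2.trans k2'.symm)
  exact (hr.perm hS).apply_eq hr' (Multiset.map_injective (Prod.mk_left_injective 0)
    (k1.trans k1'.symm))

lemma IsBraceMonomial.exists_map [CharZero K]
    (hφ : ∀ (n : Letter d) (p q : N),
      φ (MultiNovikovAlgebra.op (K := K) n p q) = φ p * D K n (φ q))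
    (hx : ∀ l, φ (x l) = X (l, 0)) {β : Var d L →₀ ℕ} {z : N} (h : IsBraceMonomial K x β z) :
    ∃ c : K, c ≠ 0 ∧ φ z = monomial β c := by
  obtain ⟨S, τ, r, l, hr, rfl, hβ⟩ := h
  obtain ⟨c, hc, h⟩ := exists_map_isBraceProd hφ hx hr
  refine ⟨c, hc, ?_⟩
  rw [h, hx, ← Multiset.prod_cons, ← Multiset.map_cons, ← Multiset.cons_add,
    ← Multiset.map_cons (fun q => (q, 0)), hβ, prod_map_X, Finsupp.toMultiset_toFinsupp, smul_monomial,
    smul_eq_mul, mul_one]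

/-- A linear left inverse on the span of the brace monomials. -/
lemma exists_leftInverse_of_isBraceMonomial [CharZero K]
    (hφ : ∀ (n : Letter d) (p q : N),
      φ (MultiNovikovAlgebra.op (K := K) n p q) = φ p * D K n (φ q))
    (hx : ∀ l, φ (x l) = X (l, 0)) :
    ∃ s : Poly K d L →ₗ[K] N, ∀ (β : Var d L →₀ ℕ) (z : N), IsBraceMonomial K x β z →
      s (φ z) = z := by
  classical
  choose! c hc hcφ using fun (β : Var d L →₀ ℕ) (z : N) (h : IsBraceMonomial K x β z) =>
    h.exists_map hφ hx
  -- Each `β` carries at most one brace monomial, so the map can be prescribed on the monomial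
  -- basis, with `0` where there is none.
  refine ⟨(basisMonomials (Var d L) K).constr K fun β =>
    if h : ∃ z, IsBraceMonomial K x β z then (c β h.choose)⁻¹ • h.choose else 0, fun β z hz => ?_⟩
  have h : ∃ z, IsBraceMonomial K x β z := ⟨z, hz⟩
  have hb : (monomial β (c β z) : Poly K d L) = c β z • basisMonomials (Var d L) K β := by
    rw [coe_basisMonomials, smul_monomial, smul_eq_mul, mul_one]
  rw [hcφ β z hz, hb, map_smul, Module.Basis.constr_basis, dif_pos h, h.choose_spec.unique hz,
    smul_inv_smul₀ (hc β z hz)]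

-- Being populated means that the variables with empty word number one more than the sum of `|w| -
-- 1` over the others: one serves as the generator, and the rest are exactly the arguments required.
variable (K x) in
lemma exists_isBraceMonomial {β : Var d L →₀ ℕ} (hβ : Populated β) :
    ∃ z, IsBraceMonomial K x β z := by
  classical
  set T := β.toMultiset.filter fun v => v.2 = 0 with hT
  set S := (β.toMultiset.filter fun v => ¬ v.2 = 0).toList with hS
  have hTS : T + (S : Multiset (Var d L)) = β.toMultiset := by
    rw [hT, hS, Multiset.coe_toList, Multiset.filter_add_not]
  have hT0 : ∀ v ∈ T, v.2 = 0 := fun v hv => (Multiset.mem_filter.1 hv).2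
  have hS0 : ∀ v ∈ S, v.2 ≠ 0 := fun v hv =>
    (Multiset.mem_filter.1 (Multiset.mem_toList.1 hv)).2
  rw [populated_iff, weight_eq_sum, ← hTS, Multiset.map_add, Multiset.sum_add,
    Multiset.map_congr rfl fun v hv => by rw [hT0 v hv]] at hβ
  have hsum : ∀ S : List (Var d L), (S.map fun v => 1 - (v.2.degree : ℤ)).sum =
      S.length - ((S.map fun v => v.2.degree).sum : ℕ) := by
    intro S
    induction S with
    | nil => rfl
    | cons v S ih =>
      simp only [List.map_cons, List.sum_cons, List.length_cons, ih]
      push_cast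
      ring
  rw [Multiset.map_coe, Multiset.sum_coe, hsum] at hβ
  simp only [map_zero, Nat.cast_zero, sub_zero, Multiset.map_const', Multiset.sum_replicate,
    nsmul_eq_mul, mul_one] at hβ
  have hle : S.length ≤ (S.map fun v => v.2.degree).sum := by
    have := List.card_nsmul_le_sum (S.map fun v => v.2.degree) 1 fun n hn => by
      obtain ⟨v, hv, rfl⟩ := List.mem_map.1 hn
      exact Nat.one_le_iff_ne_zero.2 fun h => hS0 v hv ((Finsupp.degree_eq_zero_iff _).1 h)
    simpa using this
  obtain ⟨u, hu⟩ := Multiset.card_pos_iff_exists_mem.1 (by omega : 0 < Multiset.card T)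
  obtain ⟨T', hT'⟩ := Multiset.exists_cons_of_mem hu
  obtain ⟨r, hr⟩ := IsBraceProd.exists_of_card K x S hS0 (T'.map Prod.fst) (by
    rw [hT', Multiset.card_cons] at hβ
    rw [Multiset.card_map]
    generalize (List.map (fun v : Var d L => v.2.degree) S).sum = c at hβ ⊢
    omega)
  refine ⟨_, S, _, r, u.1, hr, rfl, ?_⟩
  rw [← hTS, ← Multiset.map_cons, ← hT', Multiset.map_map]
  congr 1
  conv_rhs => rw [← Multiset.map_id T]
  exact Multiset.map_congr rfl fun v hv => Prod.ext rfl (hT0 v hv).symm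

end Hom

end GeneralMultiIndex

/-! ### Generation of the free algebra -/

namespace FreeMultiNovikov

variable {K A X : Type*} [Field K]

/-- A subspace containing the generators and closed under the products is everything. -/
lemma submodule_eq_top (V : Submodule K (FreeMultiNovikov K A X)) (hof : ∀ x, of K A x ∈ V)
    (hop : ∀ (a : A), ∀ x ∈ V, ∀ y ∈ V, MultiNovikovAlgebra.op (K := K) a x y ∈ V) : V = ⊤ := by
  refine Submodule.eq_top_iff'.2 fun z => ?_
  obtain ⟨z, rfl⟩ := (MultiMagAlgebra.novikovIdeal K A X).mkQ_surjective z
  induction z using Finsupp.induction_linear with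
  | zero => simp
  | add f g hf hg =>
    rw [map_add]
    exact add_mem hf hg
  | single t c =>
    rw [← mul_one c, ← smul_eq_mul, ← Finsupp.smul_single, map_smul]
    refine Submodule.smul_mem _ _ ?_
    induction t with
    | leaf x => exact hof x
    | node a s t hs ht =>
      rw [← MultiMagAlgebra.op_single]
      exact hop a _ hs _ ht

end FreeMultiNovikov

end
-- Bijectivity of the universal map
/-- The multi-Novikov algebra of populated general multi-indices is isomorphic to the free
multi-Novikov algebra generated by `L`, the generator `l` corresponding to `z_{(l,1)}`. -/
theorem theorem2p3 (K : Type*) [Field K] [CharZero K] (d : ℕ) (L : Type*) :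
    ∃ e : FreeMultiNovikov K (GeneralMultiIndex.Letter d) L ≃ₗ[K]
        GeneralMultiIndex.populatedSpan K d L,
      (∀ (n : GeneralMultiIndex.Letter d)
          (x y : FreeMultiNovikov K (GeneralMultiIndex.Letter d) L),
        e (MultiNovikovAlgebra.op (K := K) n x y) = MultiNovikovAlgebra.op (K := K) n (e x) (e y)) ∧
      ∀ l : L, e (FreeMultiNovikov.of K (GeneralMultiIndex.Letter d) l) =
        GeneralMultiIndex.gen K d l := by
  classical
  obtain ⟨ψ, ⟨hψ, hgen⟩, -⟩ := FreeMultiNovikov.existsUnique_lift (K := K)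
    (A := GeneralMultiIndex.Letter d) (GeneralMultiIndex.gen K d (L := L))
  set φ := (GeneralMultiIndex.populatedSpan K d L).subtype ∘ₗ ψ with hφ_def
  set x := FreeMultiNovikov.of K (GeneralMultiIndex.Letter d) (X := L) with hx_def
  have hφ : ∀ (n : GeneralMultiIndex.Letter d)
      (p q : FreeMultiNovikov K (GeneralMultiIndex.Letter d) L),
      φ (MultiNovikovAlgebra.op (K := K) n p q) = φ p * GeneralMultiIndex.D K n (φ q) :=
    fun n p q => congrArg Subtype.val (hψ n p q)
  have hx : ∀ l, φ (x l) = MvPolynomial.X (l, 0) := fun l => congrArg Subtype.val (hgen l)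
  have hinj : Function.Injective ψ := by
    obtain ⟨s, hs⟩ := GeneralMultiIndex.exists_leftInverse_of_isBraceMonomial hφ hx
    have htop : MultiNovikovAlgebra.braceSpan K (GeneralMultiIndex.Letter d) x = ⊤ :=
      FreeMultiNovikov.submodule_eq_top _
        (fun l => MultiNovikovAlgebra.apply_mem_braceSpan K x (one_mem _) l)
        fun a p hp q hq => MultiNovikovAlgebra.op_mem_braceSpan K x a hp hq
    -- It suffices to check the spanning set, where every element is a brace monomial for the
    -- multi-index read off from its factors.
    have hleft : s ∘ₗ φ = LinearMap.id := by
      refine LinearMap.ext_on htop ?_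
      rintro _ ⟨l, r, hr, rfl⟩
      obtain ⟨S, τ, h⟩ := MultiNovikovAlgebra.exists_isBraceProd K x hr
      exact hs (Multiset.toFinsupp ((l ::ₘ τ).map (fun q => (q, 0)) +
        (S : Multiset (GeneralMultiIndex.Var d L)))) _ ⟨S, τ, r, l, h, rfl, by simp⟩
    intro p q hpq
    rw [← LinearMap.id_apply (R := K) p, ← LinearMap.id_apply (R := K) q, ← hleft]
    simp [hφ_def, hpq]
  have hsurj : Function.Surjective ψ := by
    have hle : GeneralMultiIndex.populatedSpan K d L ≤ LinearMap.range φ := by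
      refine Submodule.span_le.2 ?_
      rintro _ ⟨β, hβ, rfl⟩
      obtain ⟨z, hz⟩ := GeneralMultiIndex.exists_isBraceMonomial K x hβ
      obtain ⟨c, hc, h⟩ := hz.exists_map hφ hx
      refine ⟨c⁻¹ • z, ?_⟩
      rw [map_smul, h, MvPolynomial.smul_monomial, smul_eq_mul, inv_mul_cancel₀ hc]
    intro p
    obtain ⟨z, hz⟩ := hle p.2
    exact ⟨z, Subtype.ext hz⟩
  exact ⟨LinearEquiv.ofBijective ψ ⟨hinj, hsurj⟩, hψ, hgen⟩
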